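/- Write $F^\sharp(z)=\overline{F(\bar z)}$ and $\mathbb{C}_+=\{z:\operatorname{Im} z>0\}$. Let $E$ be a function and suppose: (K1) there are $c>0$ and a (possibly empty or infinite) discrete set $\mathcal{Z}\subset\{z\in\mathbb{C}: -c\le \operatorname{Im} z\le c\}$, with $0\notin\mathcal{Z}$ and $\mathcal{Z}$ closed under $z\mapsto\bar z$ and $z\mapsto -z$, such that $E$ is analytic in $\mathbb{C}\setminus\mathcal{Z}$ and $E^\sharp(z)=E(-z)$ for all $z\in\mathbb{C}\setminus\mathcal{Z}$; (K2) there is a real-valued continuous function $K$ on $\mathbb{R}$ such that $K(x)=O(e^{c|x|})$ as $|x|\to\infty$ and $\displaystyle \frac{E^\sharp(z)}{E(z)}=\int_{-\infty}^{\infty}K(x)e^{ixz}\,dx$ for $\operatorname{Im} z>c$, with the same $c$ as in (K1), the integral being absolutely convergent and the equality being one of meromorphic functions; (K3) $K(x)=0$ for all $x<0$; (K6) the meromorphic function $E^\sharp/E$ on $\mathbb{C}\setminus\mathcal{Z}$ cannot be expressed as a quotient $P/Q$ of two entire functions of exponential type, $Q\not\equiv0$ (an entire function $F$ is of exponential type if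 $|F(z)|\le Ae^{B|z|}$ for some constants $A,B$ and all $z$). Suppose further that $\Theta_E=E^\sharp/E$ is (after removal of removable singularities) an inner function in $\mathbb{C}_+$, i.e. it is analytic and bounded in $\mathbb{C}_+$ and $\lim_{y\to0+}|\Theta_E(x+iy)|=1$ for almost every $x\in\mathbb{R}$. Then for every $t\ge 0$ neither $1$ nor $-1$ is an eigenvalue of the operator $\mathsf{K}[t]$ on the complex Hilbert space $L^2(-\infty,t)$ given by $$(\mathsf{K}[t]f)(x)=\int_{-\infty}^{t}K(x+y)f(y)\,dy\qquad (x<t);$$ that is, condition (K5), "there is $0<\tau\le\infty$ such that $\pm1$ are not eigenvalues of $\mathsf{K}[t]$ for every $0\le t<\tau$", holds with $\tau=\infty$. -/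

import Mathlib

open MeasureTheory Filter Topology Set Asymptotics

noncomputable section

namespace InnerKernel

/-- `F♯(z) = conj (F (conj z))`. -/
def sharp (F : ℂ → ℂ) (z : ℂ) : ℂ := starRingEnd ℂ (F (starRingEnd ℂ z))

/-- The quotient `Θ_E = E♯ / E`. It is a function on the complement of the singularities and of the
zeros of `E`; every definition below evaluates it only there. -/
def Theta (E : ℂ → ℂ) (z : ℂ) : ℂ := sharp E z / E z

/-- Condition (K1), with its constant `c` and its set `Z` of singularities made explicit.
The values of `E` at the points of `Z` are irrelevant. -/
structure K1 (E : ℂ → ℂ) (c : ℝ) (Z : Set ℂ) : Prop where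
  c_pos : 0 < c
  discrete : IsDiscrete Z
  zero_notMem : (0 : ℂ) ∉ Z
  strip : ∀ z ∈ Z, -c ≤ z.im ∧ z.im ≤ c
  conj_mem : ∀ z ∈ Z, starRingEnd ℂ z ∈ Z
  neg_mem : ∀ z ∈ Z, -z ∈ Z
  analytic : AnalyticOnNhd ℂ E Zᶜ
  sharp_eq : ∀ z ∉ Z, sharp E z = E (-z)

/-- Condition (K2), with its kernel `K` made explicit. The identity `E♯/E = F K` is one of
meromorphic functions on `Im z > c`: it is asked for at the points where `E` does not vanish. -/
structure K2 (E : ℂ → ℂ) (c : ℝ) (K : ℝ → ℝ) : Prop where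
  continuous : Continuous K
  growth : K =O[cocompact ℝ] fun x => Real.exp (c * |x|)
  integrable : ∀ z : ℂ, c < z.im →
    Integrable (fun x : ℝ => (K x : ℂ) * Complex.exp (Complex.I * x * z))
  fourier : ∀ z : ℂ, c < z.im → E z ≠ 0 →
    Theta E z = ∫ x : ℝ, (K x : ℂ) * Complex.exp (Complex.I * x * z)

/-- Condition (K3). -/
def K3 (K : ℝ → ℝ) : Prop := ∀ x < 0, K x = 0

/-- The Hilbert space `L²(-∞, t)` of complex-valued functions. -/
abbrev L2Iio (t : ℝ) : Type := Lp ℂ 2 (volume.restrict (Iio t))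

section operator

variable {K : ℝ → ℝ}

theorem memLp_kernel (hK : Continuous K) (h0 : K3 K) (t x : ℝ) :
    MemLp (fun y => (K (x + y) : ℂ)) 2 (volume.restrict (Iio t)) := by
  have hind : (fun y => (K (x + y) : ℂ)) =
      (Ici (-x)).indicator (fun y => (K (x + y) : ℂ)) := by
    funext y
    by_cases hy : y ∈ Ici (-x)
    · rw [indicator_of_mem hy]
    · rw [indicator_of_notMem hy]
      rw [mem_Ici, not_le] at hy
      rw [h0 (x + y) (by linarith)]
      simp
  have hc : Continuous (fun y => (K (x + y) : ℂ)) := by fun_prop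
  rw [hind, memLp_indicator_iff_restrict measurableSet_Ici,
    Measure.restrict_restrict measurableSet_Ici, Ici_inter_Iio]
  obtain ⟨M, hM⟩ := (isCompact_Icc (a := -x) (b := t)).exists_bound_of_continuousOn hc.continuousOn
  refine MemLp.of_bound hc.aestronglyMeasurable M ?_
  filter_upwards [ae_restrict_mem measurableSet_Ico] with y hy
  exact hM y ⟨hy.1, hy.2.le⟩

theorem integrable_kernel_mul (hK : Continuous K) (h0 : K3 K) (t x : ℝ) (f : L2Iio t) :
    Integrable (fun y => (K (x + y) : ℂ) * f y) (volume.restrict (Iio t)) :=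
  (memLp_kernel hK h0 t x).integrable_mul (Lp.memLp f)

theorem memLp_integral (hK : Continuous K) (h0 : K3 K) (t : ℝ) (f : L2Iio t) :
    MemLp (fun x => ∫ y in Iio t, (K (x + y) : ℂ) * f y) 2 (volume.restrict (Iio t)) := by
  have hmeas : AEStronglyMeasurable (fun x => ∫ y in Iio t, (K (x + y) : ℂ) * f y)
      (volume.restrict (Iio t)) := by
    have h1 : AEStronglyMeasurable (fun p : ℝ × ℝ => (K (p.1 + p.2) : ℂ) * f p.2)
        ((volume.restrict (Iio t)).prod (volume.restrict (Iio t))) := by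
      refine AEStronglyMeasurable.mul ?_ ?_
      · exact (by fun_prop : Continuous fun p : ℝ × ℝ => (K (p.1 + p.2) : ℂ)).aestronglyMeasurable
      · exact (Lp.aestronglyMeasurable f).comp_snd
    exact h1.integral_prod_right'
  have hind : (fun x => ∫ y in Iio t, (K (x + y) : ℂ) * f y) =ᵐ[volume.restrict (Iio t)]
      (Ici (-t)).indicator (fun x => ∫ y in Iio t, (K (x + y) : ℂ) * f y) := by
    refine Eventually.of_forall fun x => ?_
    by_cases hx : x ∈ Ici (-t)
    · simp only [indicator_of_mem hx]
    · simp only [indicator_of_notMem hx]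
      rw [mem_Ici, not_le] at hx
      refine setIntegral_eq_zero_of_forall_eq_zero fun y hy => ?_
      rw [h0 (x + y) (by have := mem_Iio.mp hy; linarith)]
      simp
  rw [memLp_congr_ae hind, memLp_indicator_iff_restrict measurableSet_Ici]
  have hfin : IsFiniteMeasure ((volume.restrict (Iio t)).restrict (Ici (-t))) := by
    rw [Measure.restrict_restrict measurableSet_Ici, Ici_inter_Iio]
    infer_instance
  obtain ⟨M, hM⟩ := (isCompact_Icc (a := (0 : ℝ)) (b := 2 * t)).exists_bound_of_continuousOn
    hK.continuousOn
  have hfi : IntegrableOn (fun y => ‖f y‖) (Ici (-t)) (volume.restrict (Iio t)) :=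
    (((Lp.memLp f).restrict (Ici (-t))).integrable (by norm_num)).norm
  refine MemLp.of_bound hmeas.restrict (∫ y in Ici (-t), M * ‖f y‖ ∂(volume.restrict (Iio t))) ?_
  refine ae_restrict_of_ae ?_
  filter_upwards [ae_restrict_mem measurableSet_Iio] with x hx
  rw [mem_Iio] at hx
  rw [← integral_indicator measurableSet_Ici]
  refine norm_integral_le_of_norm_le ?_ ?_
  · exact (integrable_indicator_iff measurableSet_Ici).mpr (hfi.const_mul M)
  · filter_upwards [ae_restrict_mem measurableSet_Iio] with y hy
    rw [mem_Iio] at hy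
    by_cases hy' : y ∈ Ici (-t)
    · rw [indicator_of_mem hy', norm_mul, Complex.norm_real]
      refine mul_le_mul_of_nonneg_right ?_ (norm_nonneg _)
      rcases lt_or_ge (x + y) 0 with hn | hp
      · rw [h0 _ hn, norm_zero]
        rw [mem_Ici] at hy'
        exact (norm_nonneg _).trans (hM 0 ⟨le_rfl, by linarith⟩)
      · exact hM _ ⟨hp, by linarith⟩
    · rw [indicator_of_notMem hy']
      rw [mem_Ici, not_le] at hy'
      rw [h0 (x + y) (by linarith)]
      simp

/-- The operator `K[t]` on `L²(-∞, t)`: `(K[t] f)(x) = ∫_{-∞}^t K(x + y) f(y) dy` for `x < t`. -/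
def Kop (hK : Continuous K) (h0 : K3 K) (t : ℝ) : L2Iio t →ₗ[ℂ] L2Iio t where
  toFun f := (memLp_integral hK h0 t f).toLp _
  map_add' f g := by
    rw [← MemLp.toLp_add]
    refine MemLp.toLp_congr _ _ (Eventually.of_forall fun x => ?_)
    simp only [Pi.add_apply]
    rw [← integral_add (integrable_kernel_mul hK h0 t x f) (integrable_kernel_mul hK h0 t x g)]
    refine integral_congr_ae ?_
    filter_upwards [Lp.coeFn_add f g] with y hy
    rw [hy, Pi.add_apply, mul_add]
  map_smul' a f := by
    rw [RingHom.id_apply, ← MemLp.toLp_const_smul]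
    refine MemLp.toLp_congr _ _ (Eventually.of_forall fun x => ?_)
    simp only [Pi.smul_apply]
    rw [← integral_smul]
    refine integral_congr_ae ?_
    filter_upwards [Lp.coeFn_smul a f] with y hy
    rw [hy, Pi.smul_apply, smul_eq_mul, smul_eq_mul]
    ring

theorem Kop_coeFn (hK : Continuous K) (h0 : K3 K) (t : ℝ) (f : L2Iio t) :
    Kop hK h0 t f =ᵐ[volume.restrict (Iio t)]
      fun x => ∫ y in Iio t, (K (x + y) : ℂ) * f y :=
  MemLp.coeFn_toLp (memLp_integral hK h0 t f)

/-- Condition (K5) for a given `τ ∈ (0, ∞]`. -/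
def K5 (hK : Continuous K) (h0 : K3 K) (τ : EReal) : Prop :=
  0 < τ ∧ ∀ t : ℝ, 0 ≤ t → (t : EReal) < τ →
    ¬ Module.End.HasEigenvalue (Kop hK h0 t) 1 ∧ ¬ Module.End.HasEigenvalue (Kop hK h0 t) (-1)

end operator

/-- Entire functions of (finite) exponential type. -/
def IsEntireExpType (F : ℂ → ℂ) : Prop :=
  Differentiable ℂ F ∧ ∃ A B : ℝ, ∀ z, ‖F z‖ ≤ A * Real.exp (B * ‖z‖)

/-- Condition (K6): `E♯/E` is not a quotient `P/Q` of two entire functions of exponential type.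
The excluded identity `E♯/E = P/Q` is one of meromorphic functions on the complement of the set `Z`
of singularities of `E`: it is tested where neither `E` nor `Q` vanishes. -/
def K6 (E : ℂ → ℂ) (Z : Set ℂ) : Prop :=
  ¬ ∃ P Q : ℂ → ℂ, IsEntireExpType P ∧ IsEntireExpType Q ∧ Q ≠ 0 ∧
    ∀ z ∉ Z, E z ≠ 0 → Q z ≠ 0 → Theta E z = P z / Q z

/-- Inner functions in the upper half-plane: bounded analytic functions whose vertical boundary
values have modulus one almost everywhere. -/
structure IsInner (θ : ℂ → ℂ) : Prop where
  analytic : AnalyticOnNhd ℂ θ {z | 0 < z.im}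
  bounded : ∃ M : ℝ, ∀ z : ℂ, 0 < z.im → ‖θ z‖ ≤ M
  boundary : ∀ᵐ x : ℝ, Tendsto (fun y : ℝ => ‖θ (x + y * Complex.I)‖) (𝓝[>] 0) (𝓝 1)

/-- `Θ_E = E♯/E`, a meromorphic function off the singularities `Z` of `E`, is (after removal of
its removable singularities) an inner function in the upper half-plane. -/
def ThetaIsInner (E : ℂ → ℂ) (Z : Set ℂ) : Prop :=
  ∃ θ : ℂ → ℂ, IsInner θ ∧ ∀ z : ℂ, 0 < z.im → z ∉ Z → E z ≠ 0 → θ z = Theta E z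

end InnerKernel

end

noncomputable section

namespace InnerKernel

open FourierTransform Complex
open scoped ContDiff

/-! Let H be the Hankel operator on the whole line with kernel K(x + y); its symbol is Θ_E.
Parseval's formula on a high horizontal line expresses the form of H through Θ_E. Moving that line
down to the real axis, where an inner function has modulus one, shows that H is contractive on
compactly supported functions (`norm_hankel_form_le`, `setIntegral_norm_hankel_sq_le`).

Suppose K[t]f = εf with |ε| = 1. As K vanishes on the negative axis, f vanishes left of -t; let g be
its extension by zero, which has compact support. On (-∞, t) the function Hg = εg already carries
the whole norm of g, so contractivity leaves nothing for [t, ∞), and Hg = εg on all of ℝ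
(`hankel_ae_eq_of_contractive`).

Write ĝ(z) = ∫ g(x) e^{ixz} dx. Since H turns into a reflection followed by multiplication by Θ_E
(`fourierLaplace_hankel`), Θ_E(z) ĝ(-z) = ε ĝ(z) for Im z > c, off the zeros of E. Both ĝ(z) and
ĝ(-z) are entire of exponential type and nonzero, which (K6) forbids once the identity is continued
off the half-plane (`K1.not_quotient`).

Mathlib's normalisation of the Fourier transform makes the variables differ by z = 2πw throughout.
-/

/-! ### The Fourier–Laplace transform of compactly supported functions -/

/-- The Fourier–Laplace transform `w ↦ ∫ e^{2πixw} f(x) dx`. -/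
def fourierLaplace (f : ℝ → ℂ) (w : ℂ) : ℂ :=
  ∫ x : ℝ, cexp (2 * Real.pi * I * x * w) * f x

theorem fourierLaplace_add_mul_I (f : ℝ → ℂ) (ξ y : ℝ) :
    fourierLaplace f (ξ + y * I) =
      𝓕⁻ (fun x : ℝ => (Real.exp (-(2 * Real.pi * y * x)) : ℂ) * f x) ξ := by
  rw [Real.fourierInv_eq', fourierLaplace]
  congr 1
  funext x
  rw [smul_eq_mul, ← mul_assoc, ofReal_exp, ← Complex.exp_add]
  congr 2
  simp only [RCLike.inner_apply, conj_trivial]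
  push_cast
  linear_combination (2 * Real.pi * x * y : ℂ) * I_mul_I

theorem fourierLaplace_ofReal (f : ℝ → ℂ) (ξ : ℝ) : fourierLaplace f ξ = 𝓕⁻ f ξ := by
  simpa using fourierLaplace_add_mul_I f ξ 0

theorem fourierLaplace_neg_ofReal (f : ℝ → ℂ) (ξ : ℝ) : fourierLaplace f (-ξ) = 𝓕 f ξ := by
  rw [← ofReal_neg, fourierLaplace_ofReal, Real.fourierInv_eq_fourier_neg, neg_neg]

theorem norm_exp_kernel (x : ℝ) (w : ℂ) :
    ‖cexp (2 * Real.pi * I * x * w)‖ = Real.exp (-(2 * Real.pi * w.im * x)) := by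
  rw [Complex.norm_exp]
  congr 1
  simp
  ring

theorem norm_exp_kernel_le {R x : ℝ} (hx : x ∈ Icc (-R) R) (w : ℂ) :
    ‖cexp (2 * Real.pi * I * x * w)‖ ≤ Real.exp (2 * Real.pi * R * |w.im|) := by
  rw [norm_exp_kernel, Real.exp_le_exp]
  have h1 : |x| ≤ R := abs_le.mpr hx
  have h2 : -(w.im * x) ≤ |w.im| * |x| := by rw [← abs_mul]; exact neg_le_abs _
  have h3 : |w.im| * |x| ≤ |w.im| * R := by gcongr
  nlinarith [Real.pi_pos]

section fourierLaplace

variable {f : ℝ → ℂ} {R : ℝ}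

theorem norm_exp_kernel_mul_le (hR : ∀ x ∉ Icc (-R) R, f x = 0) (x : ℝ) (w : ℂ) :
    ‖cexp (2 * Real.pi * I * x * w) * f x‖ ≤ Real.exp (2 * Real.pi * R * |w.im|) * ‖f x‖ := by
  by_cases hx : x ∈ Icc (-R) R
  · rw [norm_mul]
    gcongr
    exact norm_exp_kernel_le hx w
  · simp [hR x hx]

theorem integrable_exp_kernel_mul (hf : Integrable f) (hR : ∀ x ∉ Icc (-R) R, f x = 0) (w : ℂ) :
    Integrable fun x : ℝ => cexp (2 * Real.pi * I * x * w) * f x := by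
  refine (hf.norm.const_mul (Real.exp (2 * Real.pi * R * |w.im|))).mono' ?_ ?_
  · exact (by fun_prop : Continuous fun x : ℝ =>
      cexp (2 * Real.pi * I * x * w)).aestronglyMeasurable.mul hf.1
  · exact Eventually.of_forall fun x => norm_exp_kernel_mul_le hR x w

theorem norm_fourierLaplace_le (hf : Integrable f) (hR : ∀ x ∉ Icc (-R) R, f x = 0) (w : ℂ) :
    ‖fourierLaplace f w‖ ≤ Real.exp (2 * Real.pi * R * |w.im|) * ∫ x, ‖f x‖ := by
  rw [← integral_const_mul]
  exact norm_integral_le_of_norm_le (hf.norm.const_mul _)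
    (Eventually.of_forall fun x => norm_exp_kernel_mul_le hR x w)

theorem differentiable_fourierLaplace (hf : Integrable f) (hR : ∀ x ∉ Icc (-R) R, f x = 0) :
    Differentiable ℂ (fourierLaplace f) := by
  intro w₀
  set A : ℝ := 2 * Real.pi * R * (|w₀.im| + 1)
  have hmeas : ∀ w : ℂ, AEStronglyMeasurable (fun x : ℝ => cexp (2 * Real.pi * I * x * w) * f x) :=
    fun w => (integrable_exp_kernel_mul hf hR w).1
  refine (hasDerivAt_integral_of_dominated_loc_of_deriv_le (μ := volume)
    (F := fun (w : ℂ) (x : ℝ) => cexp (2 * Real.pi * I * x * w) * f x)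
    (F' := fun (w : ℂ) (x : ℝ) =>
      (2 * Real.pi * I * x) * (cexp (2 * Real.pi * I * x * w) * f x))
    (bound := fun x => (2 * Real.pi * R) * (Real.exp A * ‖f x‖))
    (Metric.ball_mem_nhds w₀ one_pos) (Eventually.of_forall hmeas)
    (integrable_exp_kernel_mul hf hR w₀) ?_ ?_ ?_ ?_).2.differentiableAt
  · exact (by fun_prop : Continuous fun x : ℝ =>
      (2 * Real.pi * I * x : ℂ)).aestronglyMeasurable.mul (hmeas w₀)
  · refine Eventually.of_forall fun x w hw => ?_
    by_cases hx : x ∈ Icc (-R) R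
    · have hxR : |x| ≤ R := abs_le.mpr hx
      have hR0 : 0 ≤ R := (abs_nonneg x).trans hxR
      have hw' : |w.im| ≤ |w₀.im| + 1 := by
        have h1 : |w.im - w₀.im| ≤ 1 := by
          rw [← sub_im]
          exact (abs_im_le_norm _).trans (mem_ball_iff_norm.mp hw).le
        have := abs_sub_abs_le_abs_sub w.im w₀.im
        linarith
      rw [norm_mul]
      gcongr
      · simp only [norm_mul, norm_real, Real.norm_eq_abs, norm_I, RCLike.norm_ofNat,
          abs_of_pos Real.pi_pos]
        have := Real.pi_pos
        nlinarith
      · refine (norm_exp_kernel_mul_le hR x w).trans ?_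
        gcongr
        simp only [A]
        gcongr
    · simp [hR x hx]
  · exact (hf.norm.const_mul _).const_mul _
  · refine Eventually.of_forall fun x w _ => ?_
    have h1 : HasDerivAt (fun w : ℂ => 2 * Real.pi * I * x * w) (2 * Real.pi * I * x) w := by
      simpa using (hasDerivAt_id w).const_mul (2 * Real.pi * I * x : ℂ)
    convert! (h1.cexp.mul_const (f x)) using 1
    ring

theorem fourierLaplace_deriv {φ : ℝ → ℂ} (h1 : ContDiff ℝ ∞ φ) (h2 : HasCompactSupport φ) (w : ℂ) :
    fourierLaplace (deriv φ) w = -(2 * Real.pi * I * w) * fourierLaplace φ w := by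
  have hd : ∀ x, HasDerivAt φ (deriv φ x) x := fun x =>
    (h1.differentiable (by simp)).differentiableAt.hasDerivAt
  have hc : Continuous (deriv φ) := h1.continuous_deriv (by simp)
  have hu : ∀ x : ℝ, HasDerivAt (fun x : ℝ => cexp (2 * Real.pi * I * x * w))
      (cexp (2 * Real.pi * I * x * w) * (2 * Real.pi * I * w)) x := by
    intro x
    have h3 : HasDerivAt (fun x : ℝ => 2 * Real.pi * I * (x : ℂ) * w) (2 * Real.pi * I * w) x := by
      simpa using (((hasDerivAt_id x).ofReal_comp).const_mul (2 * Real.pi * I : ℂ)).mul_const w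
    exact h3.cexp
  have hφc := h1.continuous
  have hcu : Continuous fun x : ℝ => cexp (2 * Real.pi * I * x * w) := by fun_prop
  have hcu' : Continuous fun x : ℝ =>
      cexp (2 * Real.pi * I * x * w) * (2 * Real.pi * I * w) := by fun_prop
  have := integral_mul_deriv_eq_deriv_mul_of_integrable (fun x _ => hu x) (fun x _ => hd x)
    ((hcu.mul hc).integrable_of_hasCompactSupport h2.deriv.mul_left)
    ((hcu'.mul hφc).integrable_of_hasCompactSupport h2.mul_left)
    ((hcu.mul hφc).integrable_of_hasCompactSupport h2.mul_left)
  rw [fourierLaplace, this, fourierLaplace, ← integral_const_mul, ← integral_neg]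
  congr 1
  funext x
  ring

theorem exists_eq_zero_of_hasCompactSupport (h2 : HasCompactSupport f) :
    ∃ R, ∀ x ∉ Icc (-R) R, f x = 0 := by
  obtain ⟨R, hR⟩ := h2.isCompact.isBounded.subset_closedBall 0
  refine ⟨R, fun x hx => ?_⟩
  by_contra h
  apply hx
  have := hR (subset_tsupport f h)
  rwa [Real.closedBall_eq_Icc, zero_sub, zero_add] at this

/-- One integration by parts gains one power of w. First order is enough: the contour shift involves
a product of two such transforms, which is then dominated by 1/(1 + x²). -/
theorem exists_fourierLaplace_decay {φ : ℝ → ℂ} (h1 : ContDiff ℝ ∞ φ) (h2 : HasCompactSupport φ)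
    (Y : ℝ) : ∃ C, 0 ≤ C ∧ ∀ w : ℂ, |w.im| ≤ Y → (1 + |w.re|) * ‖fourierLaplace φ w‖ ≤ C := by
  obtain ⟨R, hR⟩ := exists_eq_zero_of_hasCompactSupport h2
  obtain ⟨R', hR'⟩ := exists_eq_zero_of_hasCompactSupport h2.deriv
  have hc : Continuous (deriv φ) := h1.continuous_deriv (by simp)
  have hi := h1.continuous.integrable_of_hasCompactSupport h2 (μ := volume)
  have hi' := hc.integrable_of_hasCompactSupport h2.deriv (μ := volume)
  refine ⟨Real.exp (2 * Real.pi * |R| * Y) * (∫ x, ‖φ x‖) +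
    Real.exp (2 * Real.pi * |R'| * Y) * ∫ x, ‖deriv φ x‖, by positivity, fun w hw => ?_⟩
  have key : ∀ S : ℝ, Real.exp (2 * Real.pi * S * |w.im|) ≤ Real.exp (2 * Real.pi * |S| * Y) := by
    intro S
    have : S * |w.im| ≤ |S| * Y := by
      refine (mul_le_mul_of_nonneg_right (le_abs_self S) (abs_nonneg _)).trans ?_
      gcongr
    rw [Real.exp_le_exp]
    nlinarith [Real.pi_pos]
  have e1 := (norm_fourierLaplace_le hi hR w).trans
    (mul_le_mul_of_nonneg_right (key R) (by positivity))
  have e2 := (norm_fourierLaplace_le hi' hR' w).trans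
    (mul_le_mul_of_nonneg_right (key R') (by positivity))
  rw [fourierLaplace_deriv h1 h2, norm_mul, norm_neg] at e2
  have e3 : |w.re| ≤ ‖(2 * Real.pi * I * w : ℂ)‖ := by
    simp only [norm_mul, norm_real, Real.norm_eq_abs, norm_I, RCLike.norm_ofNat,
      abs_of_pos Real.pi_pos, mul_one]
    have := Real.pi_gt_three
    have h4 := abs_re_le_norm w
    nlinarith [norm_nonneg w]
  have e4 : |w.re| * ‖fourierLaplace φ w‖ ≤ ‖(2 * Real.pi * I * w : ℂ)‖ * ‖fourierLaplace φ w‖ := by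
    gcongr
  linarith

end fourierLaplace

/-! ### Contour shifts and Parseval's formula -/

theorem integrable_of_decay {G : ℝ → ℂ} {C : ℝ} (hm : AEStronglyMeasurable G)
    (hG : ∀ x, ‖G x‖ ≤ C * (1 + x ^ 2)⁻¹) : Integrable G :=
  (integrable_inv_one_add_sq.const_mul C).mono' hm (Eventually.of_forall hG)

/-- Integrals over horizontal lines of a holomorphic function that decays quadratically in a strip
do not depend on the line. -/
theorem integral_horizontal_eq {G : ℂ → ℂ} {a b C : ℝ} (hab : a ≤ b)
    (hd : DifferentiableOn ℂ G {w | a ≤ w.im ∧ w.im ≤ b})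
    (hG : ∀ w : ℂ, a ≤ w.im → w.im ≤ b → ‖G w‖ ≤ C * (1 + w.re ^ 2)⁻¹) :
    ∫ x : ℝ, G (x + a * I) = ∫ x : ℝ, G (x + b * I) := by
  have hint : ∀ y ∈ Icc a b, Integrable fun x : ℝ => G (x + y * I) := by
    intro y hy
    refine integrable_of_decay (C := C) (Continuous.aestronglyMeasurable ?_) fun x => ?_
    · refine hd.continuousOn.comp_continuous (by fun_prop) fun x => ?_
      simpa using hy
    · simpa using hG (x + y * I) (by simpa using hy.1) (by simpa using hy.2)
  have ha := intervalIntegral_tendsto_integral (hint a ⟨le_rfl, hab⟩) tendsto_neg_atTop_atBot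
    tendsto_id
  have hb := intervalIntegral_tendsto_integral (hint b ⟨hab, le_rfl⟩) tendsto_neg_atTop_atBot
    tendsto_id
  -- Both vertical sides of the rectangle at once: `s T` will be T and -T.
  have hside : ∀ s : ℝ → ℝ, (∀ T, s T ^ 2 = T ^ 2) →
      Tendsto (fun T : ℝ => ∫ y : ℝ in a..b, G (s T + y * I)) atTop (𝓝 0) := by
    intro s hs
    have hlim : Tendsto (fun T : ℝ => C * (1 + T ^ 2)⁻¹ * |b - a|) atTop (𝓝 0) := by
      have h1 : Tendsto (fun T : ℝ => (1 + T ^ 2)⁻¹) atTop (𝓝 0) :=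
        (tendsto_atTop_add_const_left _ _ (tendsto_pow_atTop two_ne_zero)).inv_tendsto_atTop
      simpa using (h1.const_mul C).mul_const |b - a|
    refine squeeze_zero_norm (fun T => ?_) hlim
    refine intervalIntegral.norm_integral_le_of_norm_le_const fun y hy => ?_
    rw [uIoc_of_le hab] at hy
    have := hG (s T + y * I) (by simpa using hy.1.le) (by simpa using hy.2)
    simpa [hs] using this
  have hrect : ∀ T : ℝ, (∫ x : ℝ in (-T)..T, G (x + a * I)) - (∫ x : ℝ in (-T)..T, G (x + b * I)) =
      I * (∫ y : ℝ in a..b, G ((-T : ℝ) + y * I)) - I * ∫ y : ℝ in a..b, G (T + y * I) := by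
    intro T
    have := integral_boundary_rect_eq_zero_of_differentiableOn G (⟨-T, a⟩) (⟨T, b⟩)
      (hd.mono fun w hw => by
        have := hw.2
        rw [uIcc_of_le hab] at this
        exact this)
    simp only [smul_eq_mul] at this
    linear_combination this
  have h0 : Tendsto (fun T : ℝ => (∫ x : ℝ in (-T)..T, G (x + a * I)) -
      (∫ x : ℝ in (-T)..T, G (x + b * I))) atTop (𝓝 0) := by
    simp_rw [hrect]
    simpa using ((hside (fun T => -T) (by simp)).const_mul I).sub
      ((hside (fun T => T) (by simp)).const_mul I)
  exact sub_eq_zero.mp (tendsto_nhds_unique (ha.sub hb) h0)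

/-- Self-adjointness of the inverse Fourier transform. -/
theorem integral_fourierInv_mul_eq_flip {f g : ℝ → ℂ} (hf : Integrable f) (hg : Integrable g) :
    ∫ ξ, 𝓕⁻ f ξ * g ξ = ∫ x, f x * 𝓕⁻ g x := by
  -- The inverse transform is the general Fourier integral for the negated inner product, a
  -- symmetric pairing, so flipping it changes nothing.
  have h : ∀ g : ℝ → ℂ, ∀ x, 𝓕⁻ g x =
      VectorFourier.fourierIntegral Real.fourierChar volume (-innerₗ ℝ) g x := fun g x => by
    simp [Real.fourierInv_eq, VectorFourier.fourierIntegral]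
  have hflip : (-innerₗ ℝ : ℝ →ₗ[ℝ] ℝ →ₗ[ℝ] ℝ).flip = -innerₗ ℝ := by
    ext
    simp
  simp_rw [h]
  have := VectorFourier.integral_fourierIntegral_smul_eq_flip (μ := (volume : Measure ℝ))
    (ν := (volume : Measure ℝ)) (L := (-innerₗ ℝ : ℝ →ₗ[ℝ] ℝ →ₗ[ℝ] ℝ))
    Real.continuous_fourierChar (by
      simp only [LinearMap.neg_apply, innerₗ_apply_apply]
      fun_prop) hf hg
  simpa [hflip] using this

/-- Parseval's formula for the Hankel form with kernel `k`. -/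
theorem integral_hankel_eq {k φ ψ : ℝ → ℂ} (hk : Integrable k) (hφ : ContDiff ℝ ∞ φ)
    (hφ' : HasCompactSupport φ) (hψ : ContDiff ℝ ∞ ψ) (hψ' : HasCompactSupport ψ) :
    ∫ y, φ y * ∫ x, k (x + y) * ψ x = ∫ ξ, 𝓕⁻ k ξ * (𝓕 φ ξ * 𝓕 ψ ξ) := by
  set Φ := hφ'.toSchwartzMap hφ
  set Ψ := hψ'.toSchwartzMap hψ
  -- The Hankel form depends on x + y only, so it equals the integral of k against the convolution
  -- of φ and ψ.
  set χ := SchwartzMap.convolution (ContinuousLinearMap.mul ℂ ℂ) Φ Ψ with hχ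
  have hF : ∀ ξ, 𝓕 χ ξ = 𝓕 φ ξ * 𝓕 ψ ξ := fun ξ => by
    rw [hχ, SchwartzMap.fourier_convolution_apply]
    exact Real.fourier_mul_convolution_eq Φ.integrable Ψ.integrable ξ
  have hinv : ∀ x, 𝓕⁻ (fun ξ => 𝓕 χ ξ) x = χ x := fun x => by
    rw [← SchwartzMap.fourierInv_coe]
    simp
  simp_rw [← hF]
  rw [integral_fourierInv_mul_eq_flip hk (𝓕 χ).integrable]
  simp_rw [hinv, hχ, SchwartzMap.convolution_apply]
  have hconv : ∀ u, k u * (MeasureTheory.convolution Φ Ψ (ContinuousLinearMap.mul ℂ ℂ) volume) u =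
      ∫ y, k u * (φ y * ψ (u - y)) := fun u => by
    rw [integral_const_mul]
    rfl
  simp_rw [hconv]
  obtain ⟨M, hM⟩ := hψ.continuous.bounded_above_of_compact_support hψ'
  rw [integral_integral_swap]
  · congr 1
    funext y
    rw [← integral_add_right_eq_self (fun x => k x * (φ y * ψ (x - y))) y, ← integral_const_mul]
    congr 1
    funext x
    rw [add_sub_cancel_right]
    ring
  · have hφi := hφ.continuous.integrable_of_hasCompactSupport hφ' (μ := volume)
    refine ((hk.mul_prod hφi).norm.mul_const M).mono' ?_ ?_
    · refine hk.1.comp_fst.mul (Continuous.aestronglyMeasurable ?_)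
      have := hφ.continuous
      have := hψ.continuous
      fun_prop
    · refine Eventually.of_forall fun p => ?_
      simp only [Function.uncurry, norm_mul]
      rw [← mul_assoc]
      gcongr
      exact hM _

/-! ### Contractivity of Hankel forms and operators -/

theorem integral_norm_mul_norm_le {f g : ℝ → ℂ} {μ : Measure ℝ} (hf : MemLp f 2 μ)
    (hg : MemLp g 2 μ) :
    ∫ x, ‖f x‖ * ‖g x‖ ∂μ ≤ √(∫ x, ‖f x‖ ^ 2 ∂μ) * √(∫ x, ‖g x‖ ^ 2 ∂μ) := by
  have h := integral_mul_norm_le_Lp_mul_Lq (μ := μ) (f := f) (g := g) Real.HolderConjugate.two_two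
    (by simpa using hf) (by simpa using hg)
  simpa [Real.sqrt_eq_rpow] using h

theorem norm_integral_mul_le {f g : ℝ → ℂ} {μ : Measure ℝ} (hf : MemLp f 2 μ) (hg : MemLp g 2 μ) :
    ‖∫ x, f x * g x ∂μ‖ ≤ √(∫ x, ‖f x‖ ^ 2 ∂μ) * √(∫ x, ‖g x‖ ^ 2 ∂μ) := by
  refine (norm_integral_le_integral_norm _).trans ?_
  simpa using integral_norm_mul_norm_le hf hg

/-- If the symbol of a Hankel form extends to a bounded holomorphic function on the upper half-plane
whose boundary values are unimodular, then the form is contractive. -/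
theorem norm_hankel_form_le {k : ℝ → ℂ} {W : ℂ → ℂ} {h M : ℝ} (hh : 0 < h)
    (hk : Integrable fun x : ℝ => (Real.exp (-(2 * Real.pi * h * x)) : ℂ) * k x)
    (hWd : DifferentiableOn ℂ W {w | 0 < w.im}) (hWb : ∀ w : ℂ, 0 < w.im → ‖W w‖ ≤ M)
    (hWl : ∀ᵐ ξ : ℝ, Tendsto (fun y : ℝ => ‖W (ξ + y * I)‖) (𝓝[>] 0) (𝓝 1))
    (hWk : ∀ᵐ ξ : ℝ, W (ξ + h * I) = fourierLaplace k (ξ + h * I)) {φ ψ : ℝ → ℂ}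
    (hφ : ContDiff ℝ ∞ φ) (hφ' : HasCompactSupport φ) (hψ : ContDiff ℝ ∞ ψ)
    (hψ' : HasCompactSupport ψ) :
    ‖∫ y, φ y * ∫ x, k (x + y) * ψ x‖ ≤ √(∫ x, ‖φ x‖ ^ 2) * √(∫ x, ‖ψ x‖ ^ 2) := by
  -- The holomorphic continuation of the integrand in `integral_hankel_eq`: on the real line
  -- `fourierLaplace φ (-ξ)` is 𝓕 φ ξ.
  set G : ℂ → ℂ := fun w => W w * (fourierLaplace φ (-w) * fourierLaplace ψ (-w)) with hGdef
  obtain ⟨C₁, hC₁, hφd⟩ := exists_fourierLaplace_decay hφ hφ' h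
  obtain ⟨C₂, hC₂, hψd⟩ := exists_fourierLaplace_decay hψ hψ' h
  obtain ⟨R₁, hR₁⟩ := exists_eq_zero_of_hasCompactSupport hφ'
  obtain ⟨R₂, hR₂⟩ := exists_eq_zero_of_hasCompactSupport hψ'
  have hφi := hφ.continuous.integrable_of_hasCompactSupport hφ' (μ := volume)
  have hψi := hψ.continuous.integrable_of_hasCompactSupport hψ' (μ := volume)
  have hφD := differentiable_fourierLaplace hφi hR₁
  have hψD := differentiable_fourierLaplace hψi hR₂
  have hGd : DifferentiableOn ℂ G {w | 0 < w.im} :=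
    hWd.mul ((hφD.comp differentiable_neg).mul (hψD.comp differentiable_neg)).differentiableOn
  have hM : 0 ≤ M := (norm_nonneg _).trans (hWb I (by simp))
  have hGb : ∀ w : ℂ, 0 < w.im → w.im ≤ h → ‖G w‖ ≤ M * (C₁ * C₂) * (1 + w.re ^ 2)⁻¹ := by
    intro w hw hw'
    have hab : |(-w).im| ≤ h := by rwa [neg_im, abs_neg, abs_of_pos hw]
    have e1 := hφd (-w) hab
    have e2 := hψd (-w) hab
    rw [neg_re, abs_neg] at e1 e2
    have e3 : 1 + w.re ^ 2 ≤ (1 + |w.re|) * (1 + |w.re|) := by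
      rw [← sq_abs]
      nlinarith [abs_nonneg w.re]
    rw [← div_eq_mul_inv, le_div_iff₀ (by positivity)]
    calc ‖G w‖ * (1 + w.re ^ 2)
        ≤ (M * (‖fourierLaplace φ (-w)‖ * ‖fourierLaplace ψ (-w)‖)) *
          ((1 + |w.re|) * (1 + |w.re|)) := by
          rw [hGdef, norm_mul, norm_mul]
          gcongr
          exact hWb w hw
      _ = M * (((1 + |w.re|) * ‖fourierLaplace φ (-w)‖) *
          ((1 + |w.re|) * ‖fourierLaplace ψ (-w)‖)) := by ring
      _ ≤ M * (C₁ * C₂) := by gcongr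
  -- Only the damped kernel is assumed integrable. The factor e^{-2πh(x+y)} put on k is cancelled by
  -- e^{2πhx} and e^{2πhy} put on the test functions, which moves Parseval's formula to height h.
  have hform : ∫ y, φ y * ∫ x, k (x + y) * ψ x = ∫ ξ : ℝ, G (ξ + h * I) := by
    set e : ℝ → ℝ → ℂ := fun s x => (Real.exp (-(2 * Real.pi * s * x)) : ℂ)
    have hes : ∀ s, ContDiff ℝ ∞ (e s) := fun s =>
      ofRealCLM.contDiff.comp (by fun_prop : ContDiff ℝ ∞ fun x => Real.exp (-(2 * Real.pi * s * x)))
    have hfour : ∀ (χ : ℝ → ℂ) (ξ : ℝ),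
        fourierLaplace χ (-(ξ + h * I)) = 𝓕 (fun x => e (-h) x * χ x) ξ := fun χ ξ => by
      rw [← neg_neg ξ, ← Real.fourierInv_eq_fourier_neg, ← fourierLaplace_add_mul_I]
      congr 1
      push_cast
      ring
    have h1 := integral_hankel_eq hk ((hes (-h)).mul hφ) hφ'.mul_left ((hes (-h)).mul hψ)
      hψ'.mul_left
    calc _ = ∫ y, e (-h) y * φ y * ∫ x, (e h (x + y) * k (x + y)) * (e (-h) x * ψ x) := by
          congr 1
          funext y
          rw [mul_comm (e (-h) y), mul_assoc, ← integral_const_mul (e (-h) y)]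
          congr 2
          funext x
          have : e (-h) y * e h (x + y) * e (-h) x = 1 := by
            simp only [e, ← ofReal_mul, ← Real.exp_add]
            rw [← ofReal_one, ← Real.exp_zero]
            congr 2
            ring
          linear_combination (-(k (x + y) * ψ x)) * this
      _ = _ := h1
      _ = _ := by
          refine integral_congr_ae ?_
          filter_upwards [hWk] with ξ hξ
          rw [hGdef]
          simp only
          rw [hξ, hfour, hfour, fourierLaplace_add_mul_I]
  have hshift : ∀ y ∈ Ioc 0 h, ∫ ξ : ℝ, G (ξ + y * I) = ∫ ξ : ℝ, G (ξ + h * I) := fun y hy =>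
    integral_horizontal_eq hy.2 (hGd.mono fun w hw => hy.1.trans_le hw.1)
      fun w hw hw' => hGb w (hy.1.trans_le hw) hw'
  have hev : ∀ᶠ y : ℝ in 𝓝[>] 0, y ∈ Ioc 0 h := Ioc_mem_nhdsGT hh
  -- Norms are taken before the limit because only |W|, not W, is assumed to have boundary values.
  have hlim : Tendsto (fun y : ℝ => ∫ ξ : ℝ, ‖G (ξ + y * I)‖) (𝓝[>] 0)
      (𝓝 (∫ ξ : ℝ, ‖𝓕 φ ξ‖ * ‖𝓕 ψ ξ‖)) := by
    refine tendsto_integral_filter_of_dominated_convergence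
      (fun ξ => M * (C₁ * C₂) * (1 + ξ ^ 2)⁻¹) ?_ ?_ (integrable_inv_one_add_sq.const_mul _) ?_
    · filter_upwards [hev] with y hy
      refine (Continuous.aestronglyMeasurable ?_).norm
      exact hGd.continuousOn.comp_continuous (by fun_prop) fun x => by simpa using hy.1
    · filter_upwards [hev] with y hy
      refine Eventually.of_forall fun ξ => ?_
      rw [norm_norm]
      simpa using hGb (ξ + y * I) (by simpa using hy.1) (by simpa using hy.2)
    · filter_upwards [hWl] with ξ hξ
      have hc : ∀ {χ : ℝ → ℂ}, Differentiable ℂ (fourierLaplace χ) →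
          Tendsto (fun y : ℝ => ‖fourierLaplace χ (-(ξ + y * I))‖) (𝓝[>] 0) (𝓝 ‖𝓕 χ ξ‖) := by
        intro χ hχ
        have hc : Continuous fun y : ℝ => ‖fourierLaplace χ (-(ξ + y * I))‖ :=
          (hχ.continuous.comp (by fun_prop)).norm
        have := (hc.tendsto 0).mono_left (nhdsWithin_le_nhds (s := Ioi 0))
        simpa [← fourierLaplace_neg_ofReal] using this
      simpa [hGdef] using hξ.mul ((hc hφD).mul (hc hψD))
  have hle : ‖∫ ξ : ℝ, G (ξ + h * I)‖ ≤ ∫ ξ : ℝ, ‖𝓕 φ ξ‖ * ‖𝓕 ψ ξ‖ := by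
    refine ge_of_tendsto hlim ?_
    filter_upwards [hev] with y hy
    rw [← hshift y hy]
    exact norm_integral_le_integral_norm _
  rw [hform]
  refine hle.trans ?_
  set Φ := hφ'.toSchwartzMap hφ
  set Ψ := hψ'.toSchwartzMap hψ
  have hΦ : ((𝓕 Φ : SchwartzMap ℝ ℂ) : ℝ → ℂ) = 𝓕 φ := SchwartzMap.fourier_coe Φ
  have hΨ : ((𝓕 Ψ : SchwartzMap ℝ ℂ) : ℝ → ℂ) = 𝓕 ψ := SchwartzMap.fourier_coe Ψ
  rw [← hΦ, ← hΨ]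
  refine (integral_norm_mul_norm_le ((𝓕 Φ).memLp 2) ((𝓕 Ψ).memLp 2)).trans_eq ?_
  rw [SchwartzMap.integral_norm_sq_fourier, SchwartzMap.integral_norm_sq_fourier]
  rfl

/-- A continuous function whose pairings with test functions are bounded by `C` times their `L²` norm
has `L²` norm at most `C`. -/
theorem setIntegral_norm_sq_le_of_pairing {A : ℝ → ℂ} {C : ℝ} (hA : Continuous A) (hC : 0 ≤ C)
    (h : ∀ φ : ℝ → ℂ, ContDiff ℝ ∞ φ → HasCompactSupport φ →
      ‖∫ x, φ x * A x‖ ≤ √(∫ x, ‖φ x‖ ^ 2) * C) (R : ℝ) :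
    ∫ x in Icc (-R) R, ‖A x‖ ^ 2 ≤ C ^ 2 := by
  -- The ideal test function is the conjugate of A, cut off by a trapezoid η and then approximated
  -- uniformly by smooth functions with no larger support.
  set η : ℝ → ℝ := fun x => max 0 (min 1 (R + 1 - |x|)) with hη
  have hηc : Continuous η := by fun_prop
  have hη0 : ∀ x, 0 ≤ η x := fun x => le_max_left _ _
  have hη1 : ∀ x, η x ≤ 1 := fun x => max_le zero_le_one (min_le_left _ _)
  have hηs : ∀ x, x ∉ Icc (-(R + 1)) (R + 1) → η x = 0 := fun x hx => by
    have : R + 1 < |x| := lt_of_not_ge fun h' => hx (abs_le.mp h')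
    exact max_eq_left ((min_le_right _ _).trans (by linarith))
  have hηR : ∀ x ∈ Icc (-R) R, η x = 1 := fun x hx => by
    have : |x| ≤ R := abs_le.mpr hx
    simp only [hη]
    rw [min_eq_left (by linarith), max_eq_right zero_le_one]
  set F : ℝ → ℂ := fun x => η x * starRingEnd ℂ (A x) with hF
  have hFc : Continuous F := by
    have := continuous_conj.comp hA
    fun_prop
  have hFA : ∀ x, F x * A x = ((η x * ‖A x‖ ^ 2 : ℝ) : ℂ) := fun x => by
    simp only [hF]
    rw [mul_assoc, conj_mul']
    push_cast
    rfl
  have happ : ∀ n : ℕ, ∃ φ : ℝ → ℂ, ContDiff ℝ ∞ φ ∧ (∀ x, dist (φ x) (F x) < 1 / ((n : ℝ) + 1)) ∧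
      Function.support φ ⊆ Function.support F := fun n =>
    hFc.exists_contDiff_approx ⊤ (ε := fun _ => 1 / ((n : ℝ) + 1)) (by fun_prop)
      (fun _ => by positivity)
  choose φ hφ1 hφ2 hφ3 using happ
  have hφs : ∀ n x, x ∉ Icc (-(R + 1)) (R + 1) → φ n x = 0 := fun n x hx => by
    by_contra hne
    exact hφ3 n hne (by simp [hF, hηs x hx])
  have hφc : ∀ n, HasCompactSupport (φ n) := fun n =>
    HasCompactSupport.intro isCompact_Icc (hφs n)
  have hφlim : ∀ x, Tendsto (fun n => φ n x) atTop (𝓝 (F x)) := fun x =>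
    tendsto_iff_dist_tendsto_zero.mpr (squeeze_zero (fun _ => dist_nonneg)
      (fun n => (hφ2 n x).le) tendsto_one_div_add_atTop_nhds_zero_nat)
  obtain ⟨M, hM⟩ := (isCompact_Icc (a := -(R + 1)) (b := R + 1)).exists_bound_of_continuousOn
    hA.continuousOn
  have hφM : ∀ n, ∀ x ∈ Icc (-(R + 1)) (R + 1), ‖φ n x‖ ≤ M + 1 := fun n x hx => by
    have h1 : ‖F x‖ ≤ M := by
      simp only [hF, norm_mul, norm_real, Real.norm_eq_abs, abs_of_nonneg (hη0 x), RCLike.norm_conj]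
      exact (mul_le_of_le_one_left (norm_nonneg _) (hη1 x)).trans (hM x hx)
    have h2 : dist (φ n x) (F x) < 1 := (hφ2 n x).trans_le (by
      rw [div_le_one (by positivity)]
      linarith [(Nat.cast_nonneg n : (0 : ℝ) ≤ n)])
    have h3 := norm_le_norm_add_norm_sub' (φ n x) (F x)
    rw [← dist_eq_norm] at h3
    linarith
  have hconst : ∀ c : ℝ, Integrable ((Icc (-(R + 1)) (R + 1)).indicator fun _ : ℝ => c) := fun c =>
    (integrable_indicator_iff measurableSet_Icc).mpr (by simp)
  have hlim1 : Tendsto (fun n => ∫ x, φ n x * A x) atTop (𝓝 (∫ x, F x * A x)) := by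
    refine tendsto_integral_of_dominated_convergence _
      (fun n => ((hφ1 n).continuous.mul hA).aestronglyMeasurable) (hconst ((M + 1) * M)) ?_
      (Eventually.of_forall fun x => (hφlim x).mul_const _)
    refine fun n => Eventually.of_forall fun x => ?_
    by_cases hx : x ∈ Icc (-(R + 1)) (R + 1)
    · rw [indicator_of_mem hx, norm_mul]
      exact mul_le_mul (hφM n x hx) (hM x hx) (norm_nonneg _)
        ((norm_nonneg _).trans (hφM n x hx))
    · rw [indicator_of_notMem hx, hφs n x hx]
      simp
  have hlim2 : Tendsto (fun n => ∫ x, ‖φ n x‖ ^ 2) atTop (𝓝 (∫ x, ‖F x‖ ^ 2)) := by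
    refine tendsto_integral_of_dominated_convergence _
      (fun n => ((hφ1 n).continuous.norm.pow 2).aestronglyMeasurable) (hconst ((M + 1) ^ 2)) ?_
      (Eventually.of_forall fun x => (hφlim x).norm.pow 2)
    refine fun n => Eventually.of_forall fun x => ?_
    by_cases hx : x ∈ Icc (-(R + 1)) (R + 1)
    · rw [indicator_of_mem hx, norm_pow, norm_norm]
      gcongr
      exact hφM n x hx
    · rw [indicator_of_notMem hx, hφs n x hx]
      simp
  have hle := le_of_tendsto_of_tendsto' hlim1.norm
    ((hlim2.sqrt).mul_const C) fun n => h (φ n) (hφ1 n) (hφc n)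
  have hint : Integrable fun x => η x * ‖A x‖ ^ 2 :=
    (by fun_prop : Continuous fun x => η x * ‖A x‖ ^ 2).integrable_of_hasCompactSupport
      (HasCompactSupport.intro (isCompact_Icc (a := -(R + 1)) (b := R + 1)) fun x hx => by
        simp [hηs x hx])
  set S := ∫ x, η x * ‖A x‖ ^ 2
  have hS0 : 0 ≤ S := integral_nonneg fun x => mul_nonneg (hη0 x) (by positivity)
  have hS : ∫ x, F x * A x = (S : ℂ) := by
    simp_rw [hFA]
    exact integral_ofReal
  have hFS : ∫ x, ‖F x‖ ^ 2 ≤ S := by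
    refine integral_mono_of_nonneg (Eventually.of_forall fun x => by positivity) hint
      (Eventually.of_forall fun x => ?_)
    simp only [hF, norm_mul, norm_real, Real.norm_eq_abs, abs_of_nonneg (hη0 x), RCLike.norm_conj]
    rw [mul_pow]
    gcongr
    nlinarith [hη0 x, hη1 x]
  rw [hS, norm_real, Real.norm_eq_abs, abs_of_nonneg hS0] at hle
  -- The bound improves itself: dividing by √S, when it is nonzero, gives S ≤ C².
  have hSC : S ≤ √S * C := hle.trans (by gcongr)
  have hSS : S ≤ C ^ 2 := by
    have h1 := Real.sq_sqrt hS0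
    have h2 := Real.sqrt_nonneg S
    rcases h2.eq_or_lt with h3 | h3
    · rw [← h3] at h1
      nlinarith
    · have : √S ≤ C := by
        by_contra! hlt
        nlinarith
      nlinarith
  refine le_trans ?_ hSS
  rw [← integral_indicator measurableSet_Icc]
  refine integral_mono_of_nonneg (Eventually.of_forall fun x => ?_) hint
    (Eventually.of_forall fun x => ?_)
  · exact indicator_nonneg (fun _ _ => by positivity) x
  · by_cases hx : x ∈ Icc (-R) R
    · simp [indicator_of_mem hx, hηR x hx]
    · simp only [indicator_of_notMem hx]
      exact mul_nonneg (hη0 x) (by positivity)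

/-- The Hankel operator with kernel `k`. -/
def hankel (k f : ℝ → ℂ) (x : ℝ) : ℂ := ∫ y, k (x + y) * f y

section hankel

variable {k f : ℝ → ℂ} {R : ℝ}

theorem continuous_hankel (hk : Continuous k) (hf : Integrable f)
    (hR : ∀ x ∉ Icc (-R) R, f x = 0) : Continuous (hankel k f) := by
  rw [continuous_iff_continuousAt]
  intro x₀
  obtain ⟨M, hM⟩ := (isCompact_Icc (a := x₀ - 1 - R) (b := x₀ + 1 + R)).exists_bound_of_continuousOn
    hk.continuousOn
  refine continuousAt_of_dominated (bound := fun y => M * ‖f y‖) ?_ ?_ (hf.norm.const_mul M) ?_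
  · exact Eventually.of_forall fun x =>
      (by fun_prop : Continuous fun y => k (x + y)).aestronglyMeasurable.mul hf.1
  · filter_upwards [Metric.ball_mem_nhds x₀ one_pos] with x hx
    rw [Real.ball_eq_Ioo] at hx
    refine Eventually.of_forall fun y => ?_
    by_cases hy : y ∈ Icc (-R) R
    · rw [norm_mul]
      gcongr
      exact hM _ ⟨by linarith [hx.1, hy.1], by linarith [hx.2, hy.2]⟩
    · simp [hR y hy]
  · exact Eventually.of_forall fun y =>
      (by fun_prop : Continuous fun x => k (x + y) * f y).continuousAt

theorem integral_mul_hankel_comm (hk : Continuous k) (hf : Integrable f)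
    (hR : ∀ x ∉ Icc (-R) R, f x = 0) {φ : ℝ → ℂ} (hφ : Continuous φ) (hφ' : HasCompactSupport φ) :
    ∫ x, φ x * hankel k f x = ∫ x, f x * hankel k φ x := by
  obtain ⟨S, hS⟩ := exists_eq_zero_of_hasCompactSupport hφ'
  obtain ⟨M, hM⟩ := (isCompact_Icc (a := -S - R) (b := S + R)).exists_bound_of_continuousOn
    hk.continuousOn
  have hφi := hφ.integrable_of_hasCompactSupport hφ' (μ := volume)
  simp_rw [hankel, ← integral_const_mul]
  rw [integral_integral_swap]
  · congr 1
    funext y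
    congr 1
    funext x
    rw [add_comm]
    ring
  · refine ((hφi.mul_prod hf).norm.const_mul M).mono' ?_ ?_
    · refine hφi.1.comp_fst.mul (AEStronglyMeasurable.mul ?_ hf.1.comp_snd)
      exact (by fun_prop : Continuous fun p : ℝ × ℝ => k (p.1 + p.2)).aestronglyMeasurable
    · refine Eventually.of_forall fun ⟨x, y⟩ => ?_
      simp only [Function.uncurry]
      by_cases hx : x ∈ Icc (-S) S
      · by_cases hy : y ∈ Icc (-R) R
        · have := hM (x + y) ⟨by linarith [hx.1, hy.1], by linarith [hx.2, hy.2]⟩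
          calc ‖φ x * (k (x + y) * f y)‖ = ‖k (x + y)‖ * ‖φ x * f y‖ := by
                simp only [norm_mul]
                ring
            _ ≤ M * ‖φ x * f y‖ := by gcongr
        · simp [hR y hy]
      · simp [hS x hx]

/-- A contractive Hankel form gives an operator that is contractive on compactly supported `L²`
functions. -/
theorem setIntegral_norm_hankel_sq_le (hk : Continuous k)
    (h : ∀ φ ψ : ℝ → ℂ, ContDiff ℝ ∞ φ → HasCompactSupport φ → ContDiff ℝ ∞ ψ →
      HasCompactSupport ψ →
      ‖∫ y, φ y * hankel k ψ y‖ ≤ √(∫ x, ‖φ x‖ ^ 2) * √(∫ x, ‖ψ x‖ ^ 2))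
    (hf : Integrable f) (hf2 : MemLp f 2) (hR : ∀ x ∉ Icc (-R) R, f x = 0) (S : ℝ) :
    ∫ x in Icc (-S) S, ‖hankel k f x‖ ^ 2 ≤ ∫ x, ‖f x‖ ^ 2 := by
  have hsq : ∀ g : ℝ → ℂ, √(∫ x, ‖g x‖ ^ 2) ^ 2 = ∫ x, ‖g x‖ ^ 2 := fun g =>
    Real.sq_sqrt (integral_nonneg fun x => by positivity)
  rw [← hsq]
  -- The pairing criterion is used twice: here for `f`, and in `hb` for a test function φ, where the
  -- hypothesis applies directly. The symmetry of the kernel in x and y links the two.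
  refine setIntegral_norm_sq_le_of_pairing (continuous_hankel hk hf hR) (Real.sqrt_nonneg _)
    (fun φ hφ hφ' => ?_) S
  obtain ⟨T, hT⟩ := exists_eq_zero_of_hasCompactSupport hφ'
  have hφc : Continuous (hankel k φ) :=
    continuous_hankel hk (hφ.continuous.integrable_of_hasCompactSupport hφ') hT
  have hb : √(∫ x in Icc (-R) R, ‖hankel k φ x‖ ^ 2) ≤ √(∫ x, ‖φ x‖ ^ 2) := by
    rw [← hsq φ]
    exact Real.sqrt_le_sqrt (setIntegral_norm_sq_le_of_pairing hφc (Real.sqrt_nonneg _)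
      (fun χ hχ hχ' => h χ φ hχ hχ' hφ hφ') R)
  have hset : ∀ {F : ℝ → ℂ}, (∀ x ∉ Icc (-R) R, F x = 0) → ∫ x in Icc (-R) R, F x = ∫ x, F x :=
    fun hF => setIntegral_eq_integral_of_forall_compl_eq_zero hF
  rw [integral_mul_hankel_comm hk hf hR hφ.continuous hφ',
    ← hset fun x hx => by rw [hR x hx, zero_mul], mul_comm]
  have hL : MemLp (hankel k φ) 2 (volume.restrict (Icc (-R) R)) := by
    obtain ⟨M, hM⟩ := (isCompact_Icc (a := -R) (b := R)).exists_bound_of_continuousOn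
      hφc.continuousOn
    refine MemLp.of_bound hφc.aestronglyMeasurable M ?_
    filter_upwards [ae_restrict_mem measurableSet_Icc] with y hy using hM y hy
  refine (norm_integral_mul_le (hf2.restrict _) hL).trans ?_
  exact mul_le_mul (Real.sqrt_le_sqrt (integral_mono_measure Measure.restrict_le_self
    (Eventually.of_forall fun x => by positivity) hf2.norm.integrable_sq)) hb
    (Real.sqrt_nonneg _) (Real.sqrt_nonneg _)

/-- The Fourier–Laplace transform turns a Hankel operator into a multiplication. -/
theorem fourierLaplace_hankel {w : ℂ}
    (hk : Integrable fun x : ℝ => cexp (2 * Real.pi * I * x * w) * k x) (hf : Integrable f)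
    (hR : ∀ x ∉ Icc (-R) R, f x = 0) :
    fourierLaplace (hankel k f) w = fourierLaplace k w * fourierLaplace f (-w) := by
  have hf' := integrable_exp_kernel_mul hf hR (-w)
  set A : ℝ → ℂ := fun x => cexp (2 * Real.pi * I * x * w) * k x with hA
  set B : ℝ → ℂ := fun x => cexp (2 * Real.pi * I * x * (-w)) * f x with hB
  -- The exponential splits as e^{-2πiyw} e^{2πi(x+y)w}; a measure-preserving shear then separates
  -- the variables and justifies Fubini.
  have hint : Integrable (Function.uncurry fun x y : ℝ => B y * A (y + x)) (volume.prod volume) :=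
    ((measurePreserving_prod_add_swap (volume : Measure ℝ)
      (volume : Measure ℝ)).integrable_comp_of_integrable (hf'.mul_prod hk))
  calc fourierLaplace (hankel k f) w = ∫ x, ∫ y, B y * A (y + x) := by
        rw [fourierLaplace]
        congr 1
        funext x
        rw [hankel, ← integral_const_mul]
        congr 1
        funext y
        have : cexp (2 * Real.pi * I * x * w) =
            cexp (2 * Real.pi * I * y * (-w)) * cexp (2 * Real.pi * I * (y + x : ℝ) * w) := by
          rw [← Complex.exp_add]
          congr 1
          push_cast
          ring
        simp only [hA, hB]
        rw [this, add_comm x y]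
        ring
    _ = ∫ y, ∫ x, B y * A (y + x) := integral_integral_swap hint
    _ = ∫ y, B y * ∫ x, A x := by
        congr 1
        funext y
        rw [integral_const_mul, integral_add_left_eq_self A y]
    _ = _ := by
        rw [integral_mul_const, mul_comm]
        rfl

end hankel

/-- The Fourier–Laplace transform is injective on integrable functions. -/
theorem ae_eq_zero_of_fourierLaplace_eq_zero {f : ℝ → ℂ} (hf : Integrable f)
    (h : ∀ ξ : ℝ, fourierLaplace f ξ = 0) : ∀ᵐ x, f x = 0 := by
  refine ae_eq_zero_of_integral_contDiff_smul_eq_zero hf.locallyIntegrable fun χ hχ hχ' => ?_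
  have h1 : ContDiff ℝ ∞ fun x => (χ x : ℂ) := ofRealCLM.contDiff.comp hχ
  have h2 : HasCompactSupport fun x => (χ x : ℂ) := hχ'.comp_left ofReal_zero
  set Ψ := h2.toSchwartzMap h1
  have hinv : ∀ x, 𝓕⁻ (fun ξ => 𝓕 Ψ ξ) x = χ x := fun x => by
    rw [← SchwartzMap.fourierInv_coe]
    simp [Ψ]
  have := integral_fourierInv_mul_eq_flip hf (𝓕 Ψ).integrable
  simp_rw [hinv, ← fourierLaplace_ofReal, h, zero_mul, integral_zero] at this
  rw [this]
  simp [mul_comm]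

/-! ### Analytic continuation of E♯/E and condition (K6) -/

section structure_function

variable {E : ℂ → ℂ} {c : ℝ} {Z : Set ℂ}

/-- A discrete subset of the plane is countable, and removing a countable set from a space of real
dimension two leaves it connected. Closedness of Z plays no role. -/
theorem isConnected_of_compl_subset_isDiscrete (hZ : IsDiscrete Z) {U : Set ℂ} (hU : Uᶜ ⊆ Z) :
    IsConnected U := by
  have hc : Z.Countable := (HereditarilyLindelofSpace.isLindelof Z).countable_of_isDiscrete hZ
  rw [← compl_compl U]
  exact (hc.mono hU).isConnected_compl_of_one_lt_rank (by simp)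

theorem K1.notMem (hK1 : K1 E c Z) {z : ℂ} (hz : c < z.im) : z ∉ Z := fun h =>
  absurd (hK1.strip z h).2 (not_le.mpr hz)

theorem eventually_lt_im {z : ℂ} (hz : c < z.im) : ∀ᶠ w : ℂ in 𝓝 z, c < w.im :=
  continuous_im.continuousAt.eventually (lt_mem_nhds hz)

/-- Otherwise E vanishes off Z by the identity theorem, and then 0/1 is a quotient that (K6)
excludes, its condition being vacuous. -/
theorem K1.exists_ne_zero (hK1 : K1 E c Z) (hK6 : K6 E Z) : ∃ z : ℂ, c < z.im ∧ E z ≠ 0 := by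
  by_contra! h
  have hsub : Zᶜ ⊆ {z | AnalyticAt ℂ E z} := hK1.analytic
  have hconn := isConnected_of_compl_subset_isDiscrete hK1.discrete (compl_subset_comm.mp hsub)
  set z₀ : ℂ := (c + 1 : ℝ) * I
  have hz₀ : c < z₀.im := by simp [z₀]
  have hzero : EqOn E 0 {z | AnalyticAt ℂ E z} :=
    AnalyticOnNhd.eqOn_zero_of_preconnected_of_eventuallyEq_zero (fun z hz => hz)
      hconn.isPreconnected (hsub (hK1.notMem hz₀))
      ((eventually_lt_im hz₀).mono fun w hw => h w hw)
  refine hK6 ⟨0, 1, ⟨differentiable_const 0, 0, 0, by simp⟩,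
    ⟨differentiable_const 1, 1, 0, by simp⟩, one_ne_zero, fun z hz hE _ => ?_⟩
  exact absurd (hzero (hsub hz)) hE

/-- Zeros of a nontrivial analytic function are isolated. Countability makes them negligible on a
horizontal line, where (K2) is needed almost everywhere. -/
theorem K1.countable_zeros (hK1 : K1 E c Z) (hK6 : K6 E Z) :
    {z : ℂ | E z = 0 ∧ c < z.im}.Countable := by
  obtain ⟨z₁, hz₁, hE⟩ := hK1.exists_ne_zero hK6
  have hconn : IsConnected {z : ℂ | c < z.im} :=
    ⟨⟨z₁, hz₁⟩, (convex_halfSpace_im_gt c).isPreconnected⟩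
  have hcod := AnalyticOnNhd.preimage_zero_mem_codiscreteWithin
    (hK1.analytic.mono fun z hz => hK1.notMem hz) hE hz₁ hconn
  exact (HereditarilyLindelofSpace.isLindelof _).countable_of_isDiscrete
    (isDiscrete_of_codiscreteWithin (s := E ⁻¹' {0}) hcod)

/-- Under (K6), the quotient `E♯/E` does not coincide on a half-plane with a quotient of entire
functions of exponential type. -/
theorem K1.not_quotient (hK1 : K1 E c Z) (hK6 : K6 E Z) {P Q : ℂ → ℂ} (hP : IsEntireExpType P)
    (hQ : IsEntireExpType Q) (hQ0 : Q ≠ 0)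
    (h : ∀ z : ℂ, c < z.im → E z ≠ 0 → Theta E z * Q z = P z) : False := by
  obtain ⟨z₁, hz₁, hE₁⟩ := hK1.exists_ne_zero hK6
  set U : Set ℂ := {z | AnalyticAt ℂ E z} ∩ {z | AnalyticAt ℂ E (-z)}
  have hsub : Zᶜ ⊆ U := fun z hz =>
    ⟨hK1.analytic z hz, hK1.analytic (-z) fun hz' => hz (by simpa using hK1.neg_mem _ hz')⟩
  have hconn := isConnected_of_compl_subset_isDiscrete hK1.discrete (compl_subset_comm.mp hsub)
  -- Writing E♯(z) as E(-z) and clearing denominators leaves an analytic function on a connected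
  -- set, to which the identity theorem applies.
  have hD : AnalyticOnNhd ℂ (fun z => E (-z) * Q z - P z * E z) U := fun z hz =>
    ((AnalyticAt.comp (f := fun z : ℂ => -z) hz.2 analyticAt_id.neg).mul
      (hQ.1.analyticAt z)).sub ((hP.1.analyticAt z).mul hz.1)
  have hzero := hD.eqOn_zero_of_preconnected_of_eventuallyEq_zero hconn.isPreconnected
    (hsub (hK1.notMem hz₁)) (by
      filter_upwards [eventually_lt_im hz₁,
        (hK1.analytic z₁ (hK1.notMem hz₁)).continuousAt.eventually_ne hE₁] with z hz hE
      have h1 := h z hz hE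
      rw [Theta, hK1.sharp_eq z (hK1.notMem hz)] at h1
      rw [← h1, Pi.zero_apply]
      field_simp
      ring)
  refine hK6 ⟨P, Q, hP, hQ, hQ0, fun z hz hE hQz => ?_⟩
  rw [Theta, hK1.sharp_eq z hz, div_eq_div_iff hE hQz]
  exact sub_eq_zero.mp (hzero (hsub hz))

end structure_function

/-- The easy half of Paley–Wiener. The constants `a` and `b` absorb the eigenvalue, the reflection
and the rescaling by 2π. -/
theorem isEntireExpType_fourierLaplace {f : ℝ → ℂ} {R : ℝ} (hf : Integrable f)
    (hR : ∀ x ∉ Icc (-R) R, f x = 0) (a b : ℂ) :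
    IsEntireExpType fun z => a * fourierLaplace f (b * z) := by
  have hd := differentiable_fourierLaplace hf hR
  refine ⟨(hd.comp (differentiable_id.const_mul b)).const_mul a, ‖a‖ * ∫ x, ‖f x‖,
    2 * Real.pi * |R| * ‖b‖, fun z => ?_⟩
  rw [norm_mul, mul_assoc]
  gcongr
  refine (norm_fourierLaplace_le hf hR _).trans ?_
  rw [mul_comm]
  refine mul_le_mul_of_nonneg_left (Real.exp_le_exp.mpr ?_) (by positivity)
  have h1 : |(b * z).im| ≤ ‖b‖ * ‖z‖ := (abs_im_le_norm _).trans_eq (norm_mul _ _)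
  have h2 : R * |(b * z).im| ≤ |R| * (‖b‖ * ‖z‖) :=
    mul_le_mul (le_abs_self R) h1 (abs_nonneg _) (abs_nonneg _)
  nlinarith [Real.pi_pos]

theorem ae_comp_const_mul {p : ℝ → Prop} {a : ℝ} (ha : a ≠ 0) (h : ∀ᵐ x, p x) :
    ∀ᵐ x, p (a * x) := by
  rw [ae_iff] at h ⊢
  have := Real.volume_preimage_mul_left ha {x | ¬ p x}
  rwa [h, mul_zero] at this

/-! ### Contractivity for the kernel K -/

section contraction

variable {E : ℂ → ℂ} {c : ℝ} {Z : Set ℂ} {K : ℝ → ℝ}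

theorem K2.integrable_exp_kernel (hK2 : K2 E c K) {w : ℂ} (hw : c < (2 * Real.pi * w : ℂ).im) :
    Integrable fun x : ℝ => cexp (2 * Real.pi * I * x * w) * (K x : ℂ) := by
  refine (hK2.integrable _ hw).congr (Eventually.of_forall fun x => ?_)
  simp only
  rw [mul_comm]
  congr 2
  ring

theorem K2.theta_eq (hK2 : K2 E c K) {w : ℂ} (hw : c < (2 * Real.pi * w : ℂ).im)
    (hE : E (2 * Real.pi * w) ≠ 0) :
    Theta E (2 * Real.pi * w) = fourierLaplace (fun x => (K x : ℂ)) w := by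
  rw [hK2.fourier _ hw hE, fourierLaplace]
  congr 1
  funext x
  rw [mul_comm]
  congr 2
  ring

theorem setIntegral_norm_hankel_kernel_sq_le (hK1 : K1 E c Z) (hK2 : K2 E c K) (hK6 : K6 E Z)
    (hinner : ThetaIsInner E Z) {f : ℝ → ℂ} {R : ℝ} (hf : Integrable f) (hf2 : MemLp f 2)
    (hR : ∀ x ∉ Icc (-R) R, f x = 0) (S : ℝ) :
    ∫ x in Icc (-S) S, ‖hankel (fun x => (K x : ℂ)) f x‖ ^ 2 ≤ ∫ x, ‖f x‖ ^ 2 := by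
  obtain ⟨θ, hθ, hθE⟩ := hinner
  obtain ⟨M, hM⟩ := hθ.bounded
  have hpi : (0 : ℝ) < 2 * Real.pi := by positivity
  have him : ∀ w : ℂ, (2 * Real.pi * w : ℂ).im = 2 * Real.pi * w.im := fun w => by simp
  -- Height h in w is height c + 1 in z, inside the half-plane of (K2).
  set h : ℝ := (c + 1) / (2 * Real.pi)
  have hh : 2 * Real.pi * h = c + 1 := by
    simp only [h]
    field_simp
  have hh0 : 0 < h := div_pos (by linarith [hK1.c_pos]) hpi
  have hline : ∀ ξ : ℝ, c < (2 * Real.pi * (ξ + h * I) : ℂ).im := fun ξ => by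
    rw [him]
    simp [hh]
  have hk : Integrable fun x : ℝ => (Real.exp (-(2 * Real.pi * h * x)) : ℂ) * (K x : ℂ) := by
    refine (hK2.integrable_exp_kernel (hline 0)).congr (Eventually.of_forall fun x => ?_)
    simp only
    congr 1
    push_cast
    congr 1
    linear_combination (2 * Real.pi * x * h : ℂ) * I_mul_I
  refine setIntegral_norm_hankel_sq_le (continuous_ofReal.comp hK2.continuous)
    (fun φ ψ hφ hφ' hψ hψ' => ?_) hf hf2 hR S
  have key := norm_hankel_form_le (W := fun w => θ (2 * Real.pi * w)) (M := M) hh0 hk ?_ ?_ ?_ ?_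
    hφ hφ' hψ hψ'
  · simpa only [hankel, add_comm, Function.comp_apply] using key
  · refine hθ.analytic.differentiableOn.comp (by fun_prop) fun w hw => ?_
    have : 0 < w.im := hw
    change 0 < (2 * Real.pi * w : ℂ).im
    rw [him]
    positivity
  · intro w hw
    refine hM _ ?_
    rw [him]
    positivity
  · filter_upwards [ae_comp_const_mul hpi.ne' hθ.boundary] with ξ hξ
    have hs : Tendsto (fun y : ℝ => 2 * Real.pi * y) (𝓝[>] 0) (𝓝[>] 0) := by
      refine tendsto_nhdsWithin_iff.mpr ⟨?_, ?_⟩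
      · have : Tendsto (fun y : ℝ => 2 * Real.pi * y) (𝓝 0) (𝓝 (2 * Real.pi * 0)) :=
          (continuous_const_mul _).tendsto 0
        rw [mul_zero] at this
        exact this.mono_left nhdsWithin_le_nhds
      · filter_upwards [self_mem_nhdsWithin] with y hy
        exact mul_pos hpi hy
    refine (hξ.comp hs).congr fun y => ?_
    simp only [Function.comp_apply]
    congr 2
    push_cast
    ring
  · have hinj : Function.Injective fun ξ : ℝ => (2 * Real.pi * (ξ + h * I) : ℂ) := by
      intro a b hab
      have h1 := congrArg re hab
      simpa [Real.pi_ne_zero] using h1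
    have hnull := ((hK1.countable_zeros hK6).preimage hinj).ae_notMem volume
    filter_upwards [hnull] with ξ hξ
    have hE : E (2 * Real.pi * (ξ + h * I)) ≠ 0 := fun h0 => hξ ⟨h0, hline ξ⟩
    rw [← hK2.theta_eq (hline ξ) hE]
    exact hθE _ (hK1.c_pos.trans (hline ξ)) (hK1.notMem (hline ξ)) hE

end contraction

/-! ### Eigenfunctions and the contradiction -/

/-- A Hankel operator with causal kernel that is contractive on compactly supported functions and
maps `g`, supported in `[-t, t)`, to a unimodular multiple of `g` on `(-∞, t)`, does so on `ℝ`. -/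
theorem hankel_ae_eq_of_contractive {k g : ℝ → ℂ} {t : ℝ} {ε : ℂ} (hε : ‖ε‖ = 1)
    (hk : Continuous k) (hg : Integrable g)
    (hsupp : ∀ x ∉ Ico (-t) t, g x = 0)
    (hcon : ∀ S : ℝ, ∫ x in Icc (-S) S, ‖hankel k g x‖ ^ 2 ≤ ∫ x, ‖g x‖ ^ 2)
    (heq : ∀ᵐ x, x < t → hankel k g x = ε * g x) : ∀ᵐ x, hankel k g x = ε * g x := by
  have hc : Continuous (hankel k g) := continuous_hankel hk hg (R := t) fun x hx =>
    hsupp x fun h => hx (Ico_subset_Icc_self h)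
  have htail : ∀ S, t ≤ S → ∀ᵐ x, x ∈ Icc (-S) S → t ≤ x → hankel k g x = 0 := by
    intro S hS
    have hint : IntegrableOn (fun x => ‖hankel k g x‖ ^ 2) (Icc (-S) S) :=
      (hc.norm.pow 2).continuousOn.integrableOn_Icc
    have hsplit := integral_inter_add_sdiff (t := Iio t) measurableSet_Iio hint
    -- The part below t exhausts the bound in `hcon`, so the part above t has norm zero.
    have hfirst : ∫ x in Icc (-S) S ∩ Iio t, ‖hankel k g x‖ ^ 2 = ∫ x, ‖g x‖ ^ 2 := by
      have hgS : ∫ x in Icc (-S) S ∩ Iio t, ‖g x‖ ^ 2 = ∫ x, ‖g x‖ ^ 2 := by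
        refine setIntegral_eq_integral_of_forall_compl_eq_zero fun x hx => ?_
        rw [hsupp x fun h => hx ⟨⟨by linarith [h.1], by linarith [h.2]⟩, h.2⟩]
        simp
      rw [← hgS]
      refine setIntegral_congr_ae (measurableSet_Icc.inter measurableSet_Iio) ?_
      filter_upwards [heq] with x hx hxt
      rw [hx hxt.2, norm_mul, hε, one_mul]
    have hle := hcon S
    rw [← hsplit, hfirst] at hle
    have hzero : ∫ x in Icc (-S) S \ Iio t, ‖hankel k g x‖ ^ 2 = 0 :=
      le_antisymm (by linarith) (integral_nonneg fun x => by positivity)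
    rw [setIntegral_eq_zero_iff_of_nonneg_ae (Eventually.of_forall fun x => by positivity)
      (hint.mono_set sdiff_subset)] at hzero
    have := (ae_restrict_iff' (measurableSet_Icc.diff measurableSet_Iio)).mp hzero
    filter_upwards [this] with x hx hxS hxt
    simpa using hx ⟨hxS, not_lt.mpr hxt⟩
  have hall : ∀ᵐ x, ∀ n : ℕ, x ∈ Icc (-(|t| + n)) (|t| + n) → t ≤ x → hankel k g x = 0 :=
    ae_all_iff.mpr fun n => htail _ (by linarith [le_abs_self t, (Nat.cast_nonneg n : (0 : ℝ) ≤ n)])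
  filter_upwards [heq, hall] with x hx hx'
  rcases lt_or_ge x t with hxt | hxt
  · exact hx hxt
  · obtain ⟨n, hn⟩ := exists_nat_ge |x|
    have := hx' n (abs_le.mp (by linarith [abs_nonneg t])) hxt
    rw [this, hsupp x fun h => not_lt.mpr hxt h.2, mul_zero]

/-- An eigenfunction of `K[t]`, restricted to `[-t, t)` and extended by zero, satisfies the
eigenvalue equation for the Hankel operator on `(-∞, t)`. -/
theorem exists_hankel_eq_of_hasEigenvalue {K : ℝ → ℝ} (hK : Continuous K) (h0 : K3 K) {t : ℝ}
    {ε : ℂ} (hε : ε ≠ 0) (h : Module.End.HasEigenvalue (Kop hK h0 t) ε) :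
    ∃ g : ℝ → ℂ, MemLp g 2 ∧ (∀ x ∉ Ico (-t) t, g x = 0) ∧ (¬ ∀ᵐ x, g x = 0) ∧
      ∀ᵐ x, x < t → hankel (fun x => (K x : ℂ)) g x = ε * g x := by
  obtain ⟨f, hf⟩ := h.exists_hasEigenvector
  have heq : ∀ᵐ x, x < t → ∫ y in Iio t, (K (x + y) : ℂ) * f y = ε * f x := by
    have h1 := Kop_coeFn hK h0 t f
    rw [hf.apply_eq_smul] at h1
    refine (ae_restrict_iff' measurableSet_Iio).mp ?_
    filter_upwards [h1, Lp.coeFn_smul ε f] with x hx hx'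
    rw [← hx, hx']
    rfl
  -- For x < -t and y < t the argument x + y is negative, so the integral vanishes and εf(x) = 0.
  have hfsupp : ∀ᵐ x, x < t → x ∉ Ico (-t) t → f x = 0 := by
    filter_upwards [heq] with x hx hxt hxI
    have hxt' : x < -t := by
      by_contra! hlt
      exact hxI ⟨hlt, hxt⟩
    have := hx hxt
    rw [setIntegral_eq_zero_of_forall_eq_zero fun y hy => by
      rw [h0 (x + y) (by linarith [mem_Iio.mp hy])]
      simp] at this
    exact (mul_eq_zero.mp this.symm).resolve_left hε
  have hgf : ∀ᵐ x, x < t → (Ico (-t) t).indicator f x = f x := by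
    filter_upwards [hfsupp] with x hx hxt
    by_cases hxI : x ∈ Ico (-t) t
    · exact indicator_of_mem hxI _
    · rw [indicator_of_notMem hxI, hx hxt hxI]
  refine ⟨(Ico (-t) t).indicator f, ?_, fun x hx => indicator_of_notMem hx _, fun hz => ?_, ?_⟩
  · rw [memLp_indicator_iff_restrict measurableSet_Ico]
    exact (Lp.memLp f).mono_measure (Measure.restrict_mono Ico_subset_Iio_self le_rfl)
  · refine hf.2 ((Lp.eq_zero_iff_ae_eq_zero).mpr ?_)
    refine (ae_restrict_iff' measurableSet_Iio).mpr ?_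
    filter_upwards [hz, hgf] with x hx hx' hxt
    rw [← hx' hxt, hx]
    rfl
  · filter_upwards [heq, hgf] with x hx hx' hxt
    rw [hx' hxt, ← hx hxt, hankel, ← integral_indicator measurableSet_Iio]
    refine integral_congr_ae ?_
    filter_upwards [hgf] with y hy
    by_cases hyt : y ∈ Iio t
    · rw [indicator_of_mem hyt, hy hyt]
    · rw [indicator_of_notMem hyt, indicator_of_notMem fun h => hyt h.2, mul_zero]

/-- The argument only compares norms, so it rules out every unimodular ε, not just ±1. -/
theorem not_hasEigenvalue_Kop {E : ℂ → ℂ} {c : ℝ} {Z : Set ℂ} {K : ℝ → ℝ} (hK1 : K1 E c Z)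
    (hK2 : K2 E c K) (hK3 : K3 K) (hK6 : K6 E Z) (hinner : ThetaIsInner E Z) (t : ℝ) {ε : ℂ}
    (hε : ‖ε‖ = 1) : ¬ Module.End.HasEigenvalue (Kop hK2.continuous hK3 t) ε := by
  intro hev
  obtain ⟨g, hg2, hsupp, hne, heq⟩ := exists_hankel_eq_of_hasEigenvalue hK2.continuous hK3
    (norm_ne_zero_iff.mp (by simp [hε])) hev
  have hsupp' : ∀ x ∉ Icc (-t) t, g x = 0 := fun x hx =>
    hsupp x fun h => hx (Ico_subset_Icc_self h)
  have hg : Integrable g := by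
    have h1 : g = (Icc (-t) t).indicator g := by
      funext x
      by_cases hx : x ∈ Icc (-t) t
      · rw [indicator_of_mem hx]
      · rw [indicator_of_notMem hx, hsupp' x hx]
    rw [h1, integrable_indicator_iff measurableSet_Icc]
    exact (hg2.restrict (Icc (-t) t)).integrable (by norm_num)
  have hH := hankel_ae_eq_of_contractive hε (continuous_ofReal.comp hK2.continuous) hg hsupp
    (setIntegral_norm_hankel_kernel_sq_le hK1 hK2 hK6 hinner hg hg2 hsupp') heq
  have hpi : (2 * Real.pi : ℂ) ≠ 0 := by simp [Real.pi_ne_zero]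
  -- Here P(z) = ε ĝ(z) and Q(z) = ĝ(-z); Q is not identically zero because the transform is
  -- injective and g is not null.
  refine hK1.not_quotient hK6 (isEntireExpType_fourierLaplace hg hsupp' ε (2 * Real.pi : ℂ)⁻¹)
    (isEntireExpType_fourierLaplace hg hsupp' 1 (-(2 * Real.pi : ℂ)⁻¹)) (fun hQ => hne ?_)
    fun z hz hE => ?_
  · refine ae_eq_zero_of_fourierLaplace_eq_zero hg fun ξ => ?_
    have h1 := congrFun hQ (-(2 * Real.pi * ξ))
    have h2 : -(2 * Real.pi : ℂ)⁻¹ * -(2 * Real.pi * ξ) = ξ := by field_simp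
    simpa only [h2, one_mul, Pi.zero_apply] using h1
  · set w : ℂ := (2 * Real.pi : ℂ)⁻¹ * z with hw
    have hzw : z = 2 * Real.pi * w := by rw [hw, mul_inv_cancel_left₀ hpi]
    rw [hzw] at hz hE
    have h1 := fourierLaplace_hankel (hK2.integrable_exp_kernel hz) hg hsupp'
    have h2 : fourierLaplace (hankel (fun x => (K x : ℂ)) g) w = ε * fourierLaplace g w := by
      rw [fourierLaplace, fourierLaplace, ← integral_const_mul]
      refine integral_congr_ae ?_
      filter_upwards [hH] with x hx
      rw [show hankel (fun x => (K x : ℂ)) g x = ε * g x from hx]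
      ring
    rw [one_mul, neg_mul, ← hw, ← h2, h1, hzw, hK2.theta_eq hz hE]

end InnerKernel

end

theorem theorem1p3 (E : ℂ → ℂ) (c : ℝ) (Z : Set ℂ) (K : ℝ → ℝ)
    (hK1 : InnerKernel.K1 E c Z) (hK2 : InnerKernel.K2 E c K) (hK3 : InnerKernel.K3 K)
    (hK6 : InnerKernel.K6 E Z) (hinner : InnerKernel.ThetaIsInner E Z) :
    InnerKernel.K5 hK2.continuous hK3 ⊤ :=
  ⟨EReal.zero_lt_top, fun t _ _ =>
    ⟨InnerKernel.not_hasEigenvalue_Kop hK1 hK2 hK3 hK6 hinner t (by simp),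
      InnerKernel.not_hasEigenvalue_Kop hK1 hK2 hK3 hK6 hinner t (by simp)⟩⟩
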